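/- **Setting.** Let $\mathbb k$ be a field of characteristic $0$; functions of the times $x=(x_1,x_3,\dots)$, $y=(y_1,y_3,\dots)$ are formal power series over $\mathbb k$, and matrices are indexed by $\mathbb Z\times\mathbb Z$. Put $\Lambda=(\delta_{j-i,1})$, $J=((-1)^i\delta_{i+j,0})$, $K=\Lambda J$, $\varepsilon=\mathrm{diag}[s]\Lambda^{-1}$, $\varepsilon^*=-\varepsilon^T+\Lambda$, $\xi(x,\Lambda)=\sum_{n\ge0}x_{2n+1}\Lambda^{2n+1}$, $\xi(y,\Lambda^{-1})=\sum_{n\ge0}y_{2n+1}\Lambda^{-2n-1}$. Write $P_u$ and $P_l$ for the upper (with diagonal) and strictly lower triangular parts of $P$, put $(P_1,P_2)_-=(P_{1l}-P_{2l},\,P_{2u}-P_{1u})$, and multiply pairs componentwise. A solution of the CTL hierarchy is given by $S=(S_1,S_2)$, with $S_1$ lower triangular with unit diagonal and $S_2$ upper triangular with invertible diagonal entries, such that $W=(W_1,W_2)=(S_1e^{\xi(x,\Lambda)},S_2e^{\xi(y,\Lambda^{-1})})$ satisfies $K^{-1}W_i^TK=W_i^{-1}$ $(i=1,2)$ and,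 with $L=(L_1,L_2)=W(\Lambda,\Lambda^{-1})W^{-1}$, $$\partial_{x_{2n+1}}S=-(L_1^{2n+1},0)_-S,\qquad \partial_{y_{2n+1}}S=-(0,L_2^{2n+1})_-S\qquad(n\ge0).$$ Let $M=(M_1,M_2)=W(\varepsilon,\varepsilon^*)W^{-1}$ and, for $m\ge0$, $l\in\mathbb Z$, $A_{iml}=M_i^mL_i^l-(-1)^lL_i^lM_i^m$. The additional symmetries act by $$\partial_{x^*_{m,l}}W=-(A_{1ml},0)_-W,\qquad \partial_{y^*_{m,l}}W=-(0,A_{2ml})_-W .$$ The wave functions are $\Psi_i(z)=W_i\chi(z)$ with $\chi(z)=(z^n)_{n\in\mathbb Z}$. The squared eigenfunction symmetry $\partial_\alpha$ generated by $q_1,q_2$ acts by $$\partial_\alpha W_1=(q_1\otimes Kq_2+q_2\otimes Kq_1)_lW_1,\qquad \partial_\alpha W_2=-(q_1\otimes Kq_2+q_2\otimes Kq_1)_uW_2,$$ where $(A\otimes B)_{ij}=A_iB_j$. Let $\partial_{\alpha_1}$ be the one generated by $\Psi_1(\mu)$ and $\Psi_1(-\lambda)$, and $\partial_{\alpha_2}$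 the one generated by $-\lambda^{-1}\Psi_2(\lambda^{-1})$ and $\lambda^{-1}\Psi_2(-\lambda^{-1})$. Series in $\mu,\lambda$ are formal series in $(\mu-\lambda)^m\lambda^p$, $m\ge0$, $p\in\mathbb Z$, with $\mu^a=\sum_{m\ge0}\binom am\lambda^{a-m}(\mu-\lambda)^m$ for $a\in\mathbb Z$; identities between flows are identities between their actions on $W$. **Proposition.** For every solution of the CTL hierarchy, all products in the definitions of $\partial_{\alpha_1}W$ and $\partial_{\alpha_2}W$ are formally convergent, and $$\partial_{\alpha_1}=-\sum_{m=0}^\infty\frac{(\mu-\lambda)^m}{m!}\sum_{k=-\infty}^\infty\lambda^{-k-m-1}\,\partial_{x^*_{m,m+k}},\qquad \partial_{\alpha_2}=-\sum_{k=-\infty}^\infty\lambda^{-k-1}\,\partial_{y^*_{0,k}} .$$ -/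

import Mathlib

namespace CTLHierarchy

noncomputable section

/-- The times: `Sum.inl n` is `x_{2n+1}`, `Sum.inr n` is `y_{2n+1}`. -/
abbrev Time := ℕ ⊕ ℕ

/-- Functions of `x = (x₁, x₃, …)` and `y = (y₁, y₃, …)`: formal power series in all the times. -/
abbrev Fn (𝕜 : Type*) := MvPowerSeries Time 𝕜

/-- Infinite matrices, with rows and columns indexed by `ℤ`. -/
abbrev Mat (𝕜 : Type*) := Matrix ℤ ℤ (Fn 𝕜)

variable {𝕜 : Type*} [Field 𝕜]

/-! ### Infinite sums of formal power series -/

/-- Each monomial of the times receives a contribution from finitely many terms only. -/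
def FSummable {ι : Type*} (f : ι → Fn 𝕜) : Prop :=
  ∀ n : Time →₀ ℕ, (Function.support fun k => MvPowerSeries.coeff n (f k)).Finite

/-- The sum of a family of formal power series, monomial by monomial (meaningful for families
that satisfy `FSummable`). -/
def fsum {ι : Type*} (f : ι → Fn 𝕜) : Fn 𝕜 :=
  fun n => ∑ᶠ k, MvPowerSeries.coeff n (f k)

theorem fsum_eq_single {ι : Type*} (f : ι → Fn 𝕜) (a : ι) (h : ∀ k, k ≠ a → f k = 0) :
    fsum f = f a := by
  apply MvPowerSeries.ext
  intro n
  show (∑ᶠ k, MvPowerSeries.coeff n (f k)) = _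
  rw [finsum_eq_single _ a]
  intro k hk
  rw [h k hk, map_zero]

/-! ### Infinite matrices -/

/-- All entries of the product `A B` are given by formally convergent sums. -/
def MulDefined (A B : Mat 𝕜) : Prop := ∀ i j, FSummable fun k => A i k * B k j

/-- The product of infinite matrices. -/
def mul (A B : Mat 𝕜) : Mat 𝕜 := fun i j => fsum fun k => A i k * B k j

/-- Natural powers of an infinite matrix. -/
def mpow (A : Mat 𝕜) : ℕ → Mat 𝕜
  | 0 => 1
  | n + 1 => mul (mpow A n) A

/-- Integer powers of an infinite matrix `A` with inverse `B`. -/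
def zpow (A B : Mat 𝕜) : ℤ → Mat 𝕜
  | Int.ofNat n => mpow A n
  | Int.negSucc n => mpow B (n + 1)

/-- The exponential series `∑_k A^k / k!`. -/
def mexp (A : Mat 𝕜) : Mat 𝕜 :=
  fun i j => fsum fun k : ℕ => ((k.factorial : 𝕜)⁻¹) • mpow A k i j

/-- The upper triangular part, including the diagonal. -/
def up (A : Mat 𝕜) : Mat 𝕜 := fun i j => if i ≤ j then A i j else 0

/-- The strictly lower triangular part. -/
def low (A : Mat 𝕜) : Mat 𝕜 := fun i j => if j < i then A i j else 0

/-- Entrywise partial derivative in the time `t`. -/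
def dt (t : Time) (A : Mat 𝕜) : Mat 𝕜 := fun i j => MvPowerSeries.pderiv 𝕜 t (A i j)

/-- The shift matrix `Λ = (δ_{j-i,1})`. -/
def shift : Mat 𝕜 := fun i j => if j - i = 1 then 1 else 0

/-- `Λ⁻¹ = Λᵀ`. -/
def shiftInv : Mat 𝕜 := fun i j => if j - i = -1 then 1 else 0

/-- `J = ((-1)^i δ_{i+j,0})`. -/
def matJ : Mat 𝕜 := fun i j => if i + j = 0 then MvPowerSeries.C ((-1 : 𝕜) ^ i) else 0

/-- `K = Λ J`. -/
def matK : Mat 𝕜 := mul shift matJ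

/-- `K⁻¹ = -K`. -/
def matKinv : Mat 𝕜 := -matK

theorem matK_apply (i j : ℤ) :
    (matK : Mat 𝕜) i j =
      if i + j + 1 = 0 then MvPowerSeries.C ((-1 : 𝕜) ^ (i + 1)) else 0 := by
  unfold matK mul
  rw [fsum_eq_single _ (i + 1)]
  · have h : i + 1 + j = 0 ↔ i + j + 1 = 0 := by constructor <;> intro h <;> omega
    simp [shift, matJ, h]
  · intro k hk
    have : k - i ≠ 1 := by omega
    simp [shift, this]

theorem matK_matK : mul (matK : Mat 𝕜) matK = -1 := by
  funext i j
  unfold mul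
  rw [fsum_eq_single _ (-i - 1)]
  · rw [matK_apply, matK_apply, if_pos (by ring)]
    by_cases h : i = j
    · subst h
      rw [if_pos (by ring), ← map_mul, ← zpow_add₀ (by norm_num : (-1 : 𝕜) ≠ 0)]
      have e : i + 1 + (-i - 1 + 1) = 1 := by ring
      rw [e]
      simp
    · rw [if_neg (by omega)]
      simp [h]
  · intro k hk
    rw [matK_apply, if_neg (by omega), zero_mul]

theorem matK_mul_matKinv : mul (matK : Mat 𝕜) matKinv = 1 := by
  have h : mul (matK : Mat 𝕜) matKinv = -mul matK matK := by
    funext i j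
    apply MvPowerSeries.ext
    intro n
    show (∑ᶠ k, MvPowerSeries.coeff n ((matK : Mat 𝕜) i k * (-(matK : Mat 𝕜) k j))) =
      -(∑ᶠ k, MvPowerSeries.coeff n ((matK : Mat 𝕜) i k * (matK : Mat 𝕜) k j))
    rw [← finsum_neg_distrib]
    simp only [mul_neg, map_neg]
  rw [h, matK_matK, neg_neg]

theorem matKinv_mul_matK : mul (matKinv : Mat 𝕜) matK = 1 := by
  have h : mul (matKinv : Mat 𝕜) matK = -mul matK matK := by
    funext i j
    apply MvPowerSeries.ext
    intro n
    show (∑ᶠ k, MvPowerSeries.coeff n ((-(matK : Mat 𝕜) i k) * (matK : Mat 𝕜) k j)) =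
      -(∑ᶠ k, MvPowerSeries.coeff n ((matK : Mat 𝕜) i k * (matK : Mat 𝕜) k j))
    rw [← finsum_neg_distrib]
    simp only [neg_mul, map_neg]
  rw [h, matK_matK, neg_neg]

/-- `ε = diag[s] Λ⁻¹`. -/
def eps : Mat 𝕜 := mul (Matrix.diagonal fun s : ℤ => ((s : ℤ) : Fn 𝕜)) shiftInv

/-- `ε* = -εᵀ + Λ`. -/
def epsStar : Mat 𝕜 := -(eps : Mat 𝕜).transpose + shift

/-- `ξ(t, B) = ∑_n t_{2n+1} B^{2n+1}`, where `t n` is the time with index `2n+1`. -/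
def xi (t : ℕ → Time) (B : Mat 𝕜) : Mat 𝕜 :=
  fun i j => fsum fun n : ℕ => MvPowerSeries.X (t n) * mpow B (2 * n + 1) i j

/-! ### Pairs of infinite matrices -/

/-- Pairs `(P₁, P₂)` of infinite matrices. -/
abbrev Pair (𝕜 : Type*) := Mat 𝕜 × Mat 𝕜

/-- Componentwise product of pairs. -/
def pmul (P Q : Pair 𝕜) : Pair 𝕜 := (mul P.1 Q.1, mul P.2 Q.2)

/-- The projection `(P₁, P₂)₋ = (P_{1l} - P_{2l}, P_{2u} - P_{1u})`. -/
def minusPart (P : Pair 𝕜) : Pair 𝕜 := (low P.1 - low P.2, up P.2 - up P.1)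

/-- Componentwise partial derivative of a pair. -/
def pdt (t : Time) (P : Pair 𝕜) : Pair 𝕜 := (dt t P.1, dt t P.2)

/-! ### Wave operators of the CTL hierarchy -/

/-- `W₁ = S₁ exp ξ(x, Λ)`. -/
def waveOp1 (S1 : Mat 𝕜) : Mat 𝕜 := mul S1 (mexp (xi Sum.inl shift))

/-- `W₂ = S₂ exp ξ(y, Λ⁻¹)`. -/
def waveOp2 (S2 : Mat 𝕜) : Mat 𝕜 := mul S2 (mexp (xi Sum.inr shiftInv))

/-- `A B A⁻¹`, where `Ainv` is the inverse of `A`. -/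
def conj (A B Ainv : Mat 𝕜) : Mat 𝕜 := mul (mul A B) Ainv

/-- A solution of the CTL hierarchy, given by its wave operators. -/
structure Solution (𝕜 : Type*) [Field 𝕜] where
  /-- the dressing operator `S₁ = ∑_{i ≥ 0} diag[c_i(s)] Λ^{-i}` with `c₀ = 1` -/
  S1 : Mat 𝕜
  /-- the dressing operator `S₂ = ∑_{i ≥ 0} diag[c'_i(s)] Λ^{i}` with `c'₀` invertible -/
  S2 : Mat 𝕜
  /-- the inverse of `W₁` -/
  W1inv : Mat 𝕜
  /-- the inverse of `W₂` -/
  W2inv : Mat 𝕜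
  S1_lower : ∀ i j, i < j → S1 i j = 0
  S1_diag : ∀ i, S1 i i = 1
  S2_upper : ∀ i j, j < i → S2 i j = 0
  S2_diag : ∀ i, IsUnit (S2 i i)
  W1_mul_inv : mul (waveOp1 S1) W1inv = 1
  W1_inv_mul : mul W1inv (waveOp1 S1) = 1
  W2_mul_inv : mul (waveOp2 S2) W2inv = 1
  W2_inv_mul : mul W2inv (waveOp2 S2) = 1
  /-- the CTL constraint `K⁻¹ W₁ᵀ K = W₁⁻¹` -/
  constraint1 : conj matKinv (waveOp1 S1).transpose matK = W1inv
  /-- the CTL constraint `K⁻¹ W₂ᵀ K = W₂⁻¹` -/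
  constraint2 : conj matKinv (waveOp2 S2).transpose matK = W2inv
  /-- `∂_{x_{2n+1}} S = -(L₁^{2n+1}, 0)₋ S` with `L₁ = W₁ Λ W₁⁻¹` -/
  evol_x : ∀ n : ℕ, pdt (Sum.inl n) (S1, S2) =
    -pmul (minusPart (mpow (conj (waveOp1 S1) shift W1inv) (2 * n + 1), 0)) (S1, S2)
  /-- `∂_{y_{2n+1}} S = -(0, L₂^{2n+1})₋ S` with `L₂ = W₂ Λ⁻¹ W₂⁻¹` -/
  evol_y : ∀ n : ℕ, pdt (Sum.inr n) (S1, S2) =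
    -pmul (minusPart (0, mpow (conj (waveOp2 S2) shiftInv W2inv) (2 * n + 1))) (S1, S2)

namespace Solution

variable (w : Solution 𝕜)

/-- The wave operator `W₁`. -/
def W1 : Mat 𝕜 := waveOp1 w.S1

/-- The wave operator `W₂`. -/
def W2 : Mat 𝕜 := waveOp2 w.S2

/-- The pair `W = (W₁, W₂)`. -/
def W : Pair 𝕜 := (w.W1, w.W2)

/-- `L₁ = W₁ Λ W₁⁻¹`. -/
def L1 : Mat 𝕜 := conj w.W1 shift w.W1inv

/-- `L₁⁻¹ = W₁ Λ⁻¹ W₁⁻¹`. -/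
def L1inv : Mat 𝕜 := conj w.W1 shiftInv w.W1inv

/-- `L₂ = W₂ Λ⁻¹ W₂⁻¹`. -/
def L2 : Mat 𝕜 := conj w.W2 shiftInv w.W2inv

/-- `L₂⁻¹ = W₂ Λ W₂⁻¹`. -/
def L2inv : Mat 𝕜 := conj w.W2 shift w.W2inv

/-- The Orlov-Shulman operator `M₁ = W₁ ε W₁⁻¹`. -/
def M1 : Mat 𝕜 := conj w.W1 eps w.W1inv

/-- The Orlov-Shulman operator `M₂ = W₂ ε* W₂⁻¹`. -/
def M2 : Mat 𝕜 := conj w.W2 epsStar w.W2inv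

/-- `A_{1ml} = M₁^m L₁^l - (-1)^l L₁^l M₁^m`, for `l ∈ ℤ`. -/
def A1 (m : ℕ) (l : ℤ) : Mat 𝕜 :=
  mul (mpow w.M1 m) (zpow w.L1 w.L1inv l)
    - ((-1 : 𝕜) ^ l) • mul (zpow w.L1 w.L1inv l) (mpow w.M1 m)

/-- `A_{2ml} = M₂^m L₂^l - (-1)^l L₂^l M₂^m`, for `l ∈ ℤ`. -/
def A2 (m : ℕ) (l : ℤ) : Mat 𝕜 :=
  mul (mpow w.M2 m) (zpow w.L2 w.L2inv l)
    - ((-1 : 𝕜) ^ l) • mul (zpow w.L2 w.L2inv l) (mpow w.M2 m)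

/-- The additional symmetry `∂_{x*_{m,l}} W = -(A_{1ml}, 0)₋ W`. -/
def addX (m : ℕ) (l : ℤ) : Pair 𝕜 := -pmul (minusPart (w.A1 m l, 0)) w.W

/-- The additional symmetry `∂_{y*_{m,l}} W = -(0, A_{2ml})₋ W`. -/
def addY (m : ℕ) (l : ℤ) : Pair 𝕜 := -pmul (minusPart (0, w.A2 m l)) w.W

end Solution

/-! ### Formal series in the spectral parameters -/

/-- One-variable two-sided formal series `∑_p f_p z^p`. -/
abbrev Laur (𝕜 : Type*) := ℤ → Fn 𝕜

/-- Two-parameter formal series `∑_{m ≥ 0} ∑_{p ∈ ℤ} f_{m,p} (μ - λ)^m λ^p`. -/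
abbrev Ser (R : Type*) := ℕ → ℤ → R

/-- `f(z) ↦ f(-z)`. -/
def subNeg (f : Laur 𝕜) : Laur 𝕜 := fun p => ((-1 : 𝕜) ^ p) • f p

/-- `f(z) ↦ f(z⁻¹)`. -/
def subInv (f : Laur 𝕜) : Laur 𝕜 := fun p => f (-p)

/-- `f(λ)`. -/
def atLam (f : Laur 𝕜) : Ser (Fn 𝕜) := fun m p => if m = 0 then f p else 0

/-- `f(μ)`, expanded in powers of `μ - λ` by
`μ^a = (λ + (μ - λ))^a = ∑_m (a choose m) λ^{a-m} (μ - λ)^m` for `a ∈ ℤ`. -/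
def atMu (f : Laur 𝕜) : Ser (Fn 𝕜) := fun m p => Ring.choose (p + (m : ℤ)) m • f (p + m)

/-- `F ↦ λ^n F`. -/
def lamMul (n : ℤ) (F : Ser (Fn 𝕜)) : Ser (Fn 𝕜) := fun m p => F m (p - n)

/-- The product of two formal series is given by formally convergent sums. -/
def SerMulDefined (F G : Ser (Fn 𝕜)) : Prop :=
  ∀ (a b : ℕ) (p : ℤ), FSummable fun q : ℤ => F a q * G b (p - q)

/-- The product of two formal series. -/
def serMul (F G : Ser (Fn 𝕜)) : Ser (Fn 𝕜) := fun m p =>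
  ∑ ab ∈ Finset.HasAntidiagonal.antidiagonal m, fsum fun q : ℤ => F ab.1 q * G ab.2 (p - q)

/-- Matrix times vector, for vectors of formal series. -/
def mulVec (A : Mat 𝕜) (q : ℤ → Ser (Fn 𝕜)) : ℤ → Ser (Fn 𝕜) :=
  fun i m p => fsum fun k : ℤ => A i k * q k m p

/-- The Kronecker product `(q ⊗ r)_{ij} = q_i r_j`, as a formal series of matrices. -/
def tensor (q r : ℤ → Ser (Fn 𝕜)) : Ser (Mat 𝕜) := fun m p i j => serMul (q i) (r j) m p

/-- `q₁ ⊗ K q₂ + q₂ ⊗ K q₁`. -/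
def sqMatrix (q₁ q₂ : ℤ → Ser (Fn 𝕜)) : Ser (Mat 𝕜) :=
  tensor q₁ (mulVec matK q₂) + tensor q₂ (mulVec matK q₁)

/-- The wave function `W χ(z)`, with `χ(z) = (z^i)_{i ∈ ℤ}`. -/
def waveFn (A : Mat 𝕜) : ℤ → Laur 𝕜 :=
  fun i p => fsum fun k : ℤ => A i k * (if p = k then 1 else 0)

namespace Solution

variable (w : Solution 𝕜)

/-- The CTL squared eigenfunction flow generated by `q₁, q₂`:
`∂_α W₁ = (q₁ ⊗ K q₂ + q₂ ⊗ K q₁)_l W₁`, `∂_α W₂ = -(q₁ ⊗ K q₂ + q₂ ⊗ K q₁)_u W₂`. -/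
def sqFlow (q₁ q₂ : ℤ → Ser (Fn 𝕜)) : Ser (Pair 𝕜) := fun m p =>
  (mul (low (sqMatrix q₁ q₂ m p)) w.W1, -mul (up (sqMatrix q₁ q₂ m p)) w.W2)

/-- All products that occur in the squared eigenfunction flow are given by formally convergent
sums. -/
def SqFlowDefined (q₁ q₂ : ℤ → Ser (Fn 𝕜)) : Prop :=
  (∀ i j, SerMulDefined (q₁ i) (mulVec matK q₂ j) ∧ SerMulDefined (q₂ i) (mulVec matK q₁ j)) ∧
  ∀ m p, MulDefined (low (sqMatrix q₁ q₂ m p)) w.W1 ∧ MulDefined (up (sqMatrix q₁ q₂ m p)) w.W2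

/-- `Ψ₁(μ)`. -/
def psi1Mu : ℤ → Ser (Fn 𝕜) := fun i => atMu (waveFn w.W1 i)

/-- `Ψ₁(-λ)`. -/
def psi1NegLam : ℤ → Ser (Fn 𝕜) := fun i => atLam (subNeg (waveFn w.W1 i))

/-- `Ψ₂(λ⁻¹)`. -/
def psi2InvLam : ℤ → Ser (Fn 𝕜) := fun i => atLam (subInv (waveFn w.W2 i))

/-- `Ψ₂(-λ⁻¹)`. -/
def psi2NegInvLam : ℤ → Ser (Fn 𝕜) := fun i => atLam (subInv (subNeg (waveFn w.W2 i)))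

/-- The flow `∂_{α₁}`, generated by `Ψ₁(μ)` and `Ψ₁(-λ)`. -/
def alpha1 : Ser (Pair 𝕜) := w.sqFlow w.psi1Mu w.psi1NegLam

/-- The flow `∂_{α₂}`, generated by `-λ⁻¹ Ψ₂(λ⁻¹)` and `λ⁻¹ Ψ₂(-λ⁻¹)`. -/
def alpha2 : Ser (Pair 𝕜) :=
  w.sqFlow (fun i => -lamMul (-1) (w.psi2InvLam i)) (fun i => lamMul (-1) (w.psi2NegInvLam i))

end Solution

end

end CTLHierarchy

namespace CTLHierarchy

variable {𝕜 : Type*} [Field 𝕜]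

/-! ### Formal sums -/

section FSum

variable {ι κ : Type*}

/-! The CTL constraint reflects indices: it turns the components of `K Ψᵢ` into the entries of
`Wᵢ⁻¹` (`smul_apply_neg_one_sub`). Hence each coefficient of a Kronecker product `q ⊗ K r` of wave
functions is a dressed diagonal `W diag[c(s)] Λ^k W⁻¹`. For `Ψ₁(μ) ⊗ K Ψ₁(-λ)`, expanding `μ^s`
gives `c(s) = (s choose m)`. Since `ε^m = m! diag[s choose m] Λ^{-m}`, this is `M₁^m L₁^{m+k} / m!`.
Swapping the factors gives, through the binomial with negative upper argument, `-(-1)^{m+k} L₁^{m+k}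
M₁^m / m!`. So the squared eigenfunction matrix has coefficients `A₁ / m!` (`sqMatrix_psi1`,
`A1_eq`). The second flow is the case without `μ`: its matrix is `-A₂` with `m = 0`
(`sqMatrix_psi2`). Equal matrices have equal triangular parts, which gives the flows. Convergence
and associativity are not automatic, as the wave operators fill both triangles. They are controlled
by a grading: with `x_{2n+1}` and `y_{2n+1}` of weight `2n+1`, a monomial of a given weight occurs
in `W₁` only up to a bounded height above the diagonal, and in `W₂` only down to a bounded depth
below it. Matrices with such a band on the same side can be multiplied freely. -/

theorem coeff_fsum (f : ι → Fn 𝕜) (n : Time →₀ ℕ) :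
    MvPowerSeries.coeff n (fsum f) = ∑ᶠ k, MvPowerSeries.coeff n (f k) := rfl

theorem fsummable_zero : FSummable fun _ : ι => (0 : Fn 𝕜) := by
  intro n
  simp

theorem FSummable.smul {f : ι → Fn 𝕜} (hf : FSummable f) (c : ι → 𝕜) :
    FSummable fun k => c k • f k := by
  intro n
  refine (hf n).subset fun k hk => ?_
  rw [Function.mem_support, MvPowerSeries.coeff_smul] at hk
  exact right_ne_zero_of_mul hk

theorem FSummable.comp_injective {f : ι → Fn 𝕜} (hf : FSummable f) {e : κ → ι}
    (he : Function.Injective e) : FSummable fun k => f (e k) :=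
  fun n => (hf n).preimage he.injOn

/-- Each coefficient of a product is a finite sum over the antidiagonal, and summability of `f` lets
this sum pass through the formal one. -/
theorem fsum_mul {f : ι → Fn 𝕜} (hf : FSummable f) (g : Fn 𝕜) :
    fsum f * g = fsum fun k => f k * g := by
  classical
  ext n
  rw [coeff_fsum, MvPowerSeries.coeff_mul]
  simp only [MvPowerSeries.coeff_mul, coeff_fsum]
  rw [finsum_sum_comm]
  · exact Finset.sum_congr rfl fun ab _ => finsum_mul' _ _ (hf ab.1)
  · intro ab _
    exact (hf ab.1).subset fun k hk => left_ne_zero_of_mul hk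

theorem mul_fsum {f : ι → Fn 𝕜} (hf : FSummable f) (g : Fn 𝕜) :
    g * fsum f = fsum fun k => g * f k := by
  simp only [mul_comm g, fsum_mul hf]

theorem fsum_comm {f : ι → κ → Fn 𝕜} (hf : FSummable fun x : ι × κ => f x.1 x.2) :
    (fsum fun a => fsum fun b => f a b) = fsum fun b => fsum fun a => f a b := by
  ext n
  simp only [coeff_fsum]
  have hf' : (Function.support fun x : κ × ι => MvPowerSeries.coeff n (f x.2 x.1)).Finite := by
    refine ((hf n).image Prod.swap).subset ?_
    rintro ⟨b, a⟩ h
    exact ⟨(a, b), h, rfl⟩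
  rw [← finsum_curry (fun x : ι × κ => MvPowerSeries.coeff n (f x.1 x.2)) (hf n),
    ← finsum_curry (fun x : κ × ι => MvPowerSeries.coeff n (f x.2 x.1)) hf',
    ← finsum_comp_equiv (Equiv.prodComm ι κ)]
  rfl

theorem fsum_comp_equiv (e : ι ≃ κ) (f : κ → Fn 𝕜) : (fsum fun k => f (e k)) = fsum f := by
  ext n
  simp only [coeff_fsum]
  exact finsum_comp_equiv e (f := fun k => MvPowerSeries.coeff n (f k))

/-- No summability is needed: a scalar is zero or preserves supports, so on an infinite support both
sides take the default value `0`. This makes the linearity of `mul` in its left factor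
unconditional. -/
theorem smul_fsum (c : 𝕜) (f : ι → Fn 𝕜) : c • fsum f = fsum fun k => c • f k := by
  ext n
  simp only [coeff_fsum, MvPowerSeries.coeff_smul, mul_finsum]

theorem fsum_zero : (fsum fun _ : ι => (0 : Fn 𝕜)) = 0 := by
  ext n
  simp only [coeff_fsum, map_zero, finsum_zero]

end FSum

/-! ### Banded matrices -/

/-- The weight of a monomial of the times, where `x_{2k+1}` and `y_{2k+1}` have weight `2k+1`. -/
noncomputable def wt : (Time →₀ ℕ) →+ ℤ :=
  Finsupp.liftAddHom fun t : Time => (Nat.castAddMonoidHom ℤ).comp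
    (AddMonoidHom.mulLeft (2 * Sum.elim id id t + 1))

theorem wt_single (t : Time) (a : ℕ) :
    wt (Finsupp.single t a) = ((2 * Sum.elim id id t + 1) * a : ℕ) := by
  simp [wt]

theorem wt_nonneg (n : Time →₀ ℕ) : 0 ≤ wt n := by
  induction n using Finsupp.induction_linear with
  | zero => simp
  | add f g hf hg => rw [map_add]; exact add_nonneg hf hg
  | single t a => rw [wt_single]; positivity

/-- The monomial `n` occurs only in the entries with `s (j - i) ≤ wt n + c`. -/
def Banded (s c : ℤ) (A : Mat 𝕜) : Prop :=
  ∀ n i j, wt n + c < s * (j - i) → MvPowerSeries.coeff n (A i j) = 0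

/-- The matrix is banded for some offset. -/
def IsBanded (s : ℤ) (A : Mat 𝕜) : Prop := ∃ c, Banded s c A

section Banded

variable {s : ℤ} {A B C : Mat 𝕜}

/-- The weight of a monomial splits between the two factors. The inner indices `k` and `l` are
independent so that sums shifted by a diagonal `Λ^r` are covered too. -/
theorem Banded.coeff_mul_entry_ne_zero {c d : ℤ} (hA : Banded s c A) (hB : Banded s d B)
    {n : Time →₀ ℕ} {i j k l : ℤ} (h : MvPowerSeries.coeff n (A i k * B l j) ≠ 0) :
    ∃ a b : ℤ, a + b = wt n ∧ 0 ≤ a ∧ 0 ≤ b ∧ s * (k - i) ≤ a + c ∧ s * (j - l) ≤ b + d := by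
  classical
  rw [MvPowerSeries.coeff_mul] at h
  obtain ⟨ab, hab, h⟩ := Finset.exists_ne_zero_of_sum_ne_zero h
  refine ⟨wt ab.1, wt ab.2, ?_, wt_nonneg _, wt_nonneg _, ?_, ?_⟩
  · rw [← map_add, Finset.HasAntidiagonal.mem_antidiagonal.mp hab]
  · exact not_lt.mp fun h' => left_ne_zero_of_mul h (hA _ _ _ h')
  · exact not_lt.mp fun h' => right_ne_zero_of_mul h (hB _ _ _ h')

theorem Banded.mul {c d : ℤ} (hA : Banded s c A) (hB : Banded s d B) :
    Banded s (c + d) (mul A B) := by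
  intro n i j h
  unfold CTLHierarchy.mul
  rw [coeff_fsum]
  refine finsum_eq_zero_of_forall_eq_zero fun k => ?_
  by_contra h'
  obtain ⟨a, b, hab, -, -, h1, h2⟩ := hA.coeff_mul_entry_ne_zero hB h'
  have : s * (j - i) = s * (k - i) + s * (j - k) := by ring
  omega

theorem IsBanded.mul (hA : IsBanded s A) (hB : IsBanded s B) : IsBanded s (mul A B) := by
  obtain ⟨c, hA⟩ := hA
  obtain ⟨d, hB⟩ := hB
  exact ⟨_, hA.mul hB⟩

theorem Banded.fsummable (hs : s = 1 ∨ s = -1) {c d : ℤ} (hA : Banded s c A) (hB : Banded s d B)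
    (i j r : ℤ) : FSummable fun k => A i k * B (k + r) j := by
  intro n
  obtain ⟨N, hN⟩ : ∃ N : ℤ, N = |wt n| + |c| + |d| + |i| + |j| + |r| := ⟨_, rfl⟩
  -- The two band conditions bound `k` from opposite sides; `N` is a crude bound for both.
  refine (Set.finite_Icc (-N) N).subset fun k hk => ?_
  obtain ⟨a, b, hab, ha, hb, h1, h2⟩ := hA.coeff_mul_entry_ne_zero hB hk
  rw [Set.mem_Icc]
  rcases hs with rfl | rfl <;> constructor <;> grind

theorem IsBanded.fsummable (hs : s = 1 ∨ s = -1) (hA : IsBanded s A) (hB : IsBanded s B)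
    (i j r : ℤ) : FSummable fun k => A i k * B (k + r) j := by
  obtain ⟨c, hA⟩ := hA
  obtain ⟨d, hB⟩ := hB
  exact hA.fsummable hs hB i j r

theorem IsBanded.mulDefined (hs : s = 1 ∨ s = -1) (hA : IsBanded s A) (hB : IsBanded s B) :
    MulDefined A B := by
  intro i j
  simpa using hA.fsummable hs hB i j 0

/-- Along the chain `i, k, l, j` with fixed ends, every step is bounded on the same side, so only
finitely many `k` and `l` remain. -/
theorem IsBanded.fsummable_triple (hs : s = 1 ∨ s = -1) (hA : IsBanded s A) (hB : IsBanded s B)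
    (hC : IsBanded s C) (i j : ℤ) :
    FSummable fun x : ℤ × ℤ => A i x.1 * B x.1 x.2 * C x.2 j := by
  classical
  obtain ⟨c, hA⟩ := hA
  obtain ⟨d, hB⟩ := hB
  obtain ⟨e, hC⟩ := hC
  intro n
  obtain ⟨N, hN⟩ : ∃ N : ℤ, N = |wt n| + |c| + |d| + |e| + |i| + |j| := ⟨_, rfl⟩
  refine ((Set.finite_Icc (-N) N).prod (Set.finite_Icc (-N) N)).subset ?_
  rintro ⟨k, l⟩ hk
  rw [Function.mem_support, MvPowerSeries.coeff_mul] at hk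
  obtain ⟨ab, hab, h⟩ := Finset.exists_ne_zero_of_sum_ne_zero hk
  have hw : wt ab.1 + wt ab.2 = wt n := by rw [← map_add, Finset.HasAntidiagonal.mem_antidiagonal.mp hab]
  have h3 : s * (j - l) ≤ wt ab.2 + e :=
    not_lt.mp fun h' => right_ne_zero_of_mul h (hC _ _ _ h')
  have h0 := wt_nonneg ab.2
  obtain ⟨a, b, hab', ha, hb, h1, h2⟩ :=
    hA.coeff_mul_entry_ne_zero hB (left_ne_zero_of_mul h)
  simp only [Set.mem_prod, Set.mem_Icc]
  dsimp only at h1 h2 h3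
  rcases hs with rfl | rfl <;> refine ⟨⟨?_, ?_⟩, ?_, ?_⟩ <;> grind

theorem mul_assoc_of_isBanded (hs : s = 1 ∨ s = -1) (hA : IsBanded s A) (hB : IsBanded s B)
    (hC : IsBanded s C) : mul (mul A B) C = mul A (mul B C) := by
  funext i j
  have h1 : ∀ l, (fsum fun k => A i k * B k l) * C l j = fsum fun k => A i k * B k l * C l j :=
    fun l => fsum_mul (hA.mulDefined hs hB i l) _
  have h2 : ∀ k, A i k * (fsum fun l => B k l * C l j) = fsum fun l => A i k * (B k l * C l j) :=
    fun k => mul_fsum (hB.mulDefined hs hC k j) _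
  unfold mul
  simp only [h1, h2, ← mul_assoc]
  exact (fsum_comm (hA.fsummable_triple hs hB hC i j)).symm

theorem one_mul_mat (A : Mat 𝕜) : mul 1 A = A := by
  funext i j
  unfold mul
  rw [fsum_eq_single _ i]
  · simp
  · intro k hk
    simp [Matrix.one_apply_ne' hk]

theorem mul_one_mat (A : Mat 𝕜) : mul A 1 = A := by
  funext i j
  unfold mul
  rw [fsum_eq_single _ j]
  · simp
  · intro k hk
    simp [Matrix.one_apply_ne hk]

theorem Banded.one : Banded s 0 (1 : Mat 𝕜) := by
  intro n i j h
  have := wt_nonneg n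
  have hij : i ≠ j := by
    rintro rfl
    simp at h
    omega
  simp [Matrix.one_apply_ne hij]

/-- Offsets add under products, so only offset `0` gives a band uniform in the exponent, as the
exponential series requires. -/
theorem Banded.mpow (hA : Banded s 0 A) (m : ℕ) : Banded s 0 (mpow A m) := by
  induction m with
  | zero => exact Banded.one
  | succ m ih => exact add_zero (0 : ℤ) ▸ ih.mul hA

theorem Banded.mexp (hA : Banded s 0 A) : Banded s 0 (mexp A) := by
  intro n i j h
  unfold CTLHierarchy.mexp
  rw [coeff_fsum]
  refine finsum_eq_zero_of_forall_eq_zero fun k => ?_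
  rw [MvPowerSeries.coeff_smul, hA.mpow k n i j h, mul_zero]

theorem IsBanded.mpow (hA : IsBanded s A) (m : ℕ) : IsBanded s (mpow A m) := by
  induction m with
  | zero => exact ⟨0, Banded.one⟩
  | succ m ih => exact ih.mul hA

theorem isBanded_low (A : Mat 𝕜) : IsBanded 1 (low A) := by
  refine ⟨0, fun n i j h => ?_⟩
  have := wt_nonneg n
  rw [low, if_neg (by omega), map_zero]

theorem isBanded_up (A : Mat 𝕜) : IsBanded (-1) (up A) := by
  refine ⟨0, fun n i j h => ?_⟩
  have := wt_nonneg n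
  rw [up, if_neg (by omega), map_zero]

end Banded

/-! ### Linearity of products and triangular parts -/

theorem smul_mul_mat (c : 𝕜) (A B : Mat 𝕜) : mul (c • A) B = c • mul A B := by
  funext i j
  rw [Matrix.smul_apply]
  unfold mul
  rw [smul_fsum]
  simp only [Matrix.smul_apply, smul_mul_assoc]

theorem neg_mul_mat (A B : Mat 𝕜) : mul (-A) B = -mul A B := by
  rw [← neg_one_smul 𝕜 A, smul_mul_mat, neg_one_smul]

theorem low_smul (c : 𝕜) (A : Mat 𝕜) : low (c • A) = c • low A := by
  funext i j
  simp only [low, Matrix.smul_apply, smul_ite, smul_zero]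

theorem up_smul (c : 𝕜) (A : Mat 𝕜) : up (c • A) = c • up A := by
  funext i j
  simp only [up, Matrix.smul_apply, smul_ite, smul_zero]

theorem low_zero : low (0 : Mat 𝕜) = 0 := by
  funext i j
  simp [low]

theorem up_zero : up (0 : Mat 𝕜) = 0 := by
  funext i j
  simp [up]

/-! ### Matrices supported on one diagonal -/

/-- `diag[c(s)] Λ^k`. -/
noncomputable def diagShift (c : ℤ → 𝕜) (k : ℤ) : Mat 𝕜 :=
  fun i j => if j = i + k then MvPowerSeries.C (c i) else 0

theorem isBanded_diagShift (s : ℤ) (c : ℤ → 𝕜) (k : ℤ) : IsBanded s (diagShift c k) := by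
  refine ⟨s * k, fun n i j h => ?_⟩
  have := wt_nonneg n
  rw [diagShift, if_neg, map_zero]
  rintro rfl
  rw [add_sub_cancel_left] at h
  omega

/-- The sum has a single nonzero term, so no convergence condition on `A` appears. -/
theorem mul_diagShift (A : Mat 𝕜) (c : ℤ → 𝕜) (k i j : ℤ) :
    mul A (diagShift c k) i j = c (j - k) • A i (j - k) := by
  unfold mul
  rw [fsum_eq_single _ (j - k)]
  · rw [diagShift, if_pos (by ring), mul_comm, MvPowerSeries.smul_eq_C_mul]
  · intro l hl
    rw [diagShift, if_neg (by omega), mul_zero]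

theorem diagShift_mul_diagShift (c d : ℤ → 𝕜) (k l : ℤ) :
    mul (diagShift c k) (diagShift d l) = diagShift (fun i => c i * d (i + k)) (k + l) := by
  funext i j
  rw [mul_diagShift]
  unfold diagShift
  by_cases h : j - l = i + k
  · rw [if_pos h, if_pos (by omega), h, MvPowerSeries.smul_eq_C_mul, ← map_mul, mul_comm]
  · rw [if_neg h, if_neg (by omega), smul_zero]

theorem one_eq_diagShift : (1 : Mat 𝕜) = diagShift 1 0 := by
  funext i j
  simp [diagShift, Matrix.one_apply, eq_comm]

theorem shift_eq_diagShift : (shift : Mat 𝕜) = diagShift 1 1 := by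
  funext i j
  simp only [shift, diagShift, Pi.one_apply, map_one]
  congr 1
  exact propext ⟨fun h => by omega, fun h => by omega⟩

theorem shiftInv_eq_diagShift : (shiftInv : Mat 𝕜) = diagShift 1 (-1) := by
  funext i j
  simp only [shiftInv, diagShift, Pi.one_apply, map_one]
  congr 1
  exact propext ⟨fun h => by omega, fun h => by omega⟩

theorem eps_eq_diagShift : (eps : Mat 𝕜) = diagShift (fun i => ((i : ℤ) : 𝕜)) (-1) := by
  have h : (Matrix.diagonal fun s : ℤ => ((s : ℤ) : Fn 𝕜)) =
      (diagShift (fun i => ((i : ℤ) : 𝕜)) 0 : Mat 𝕜) := by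
    funext i j
    simp [diagShift, Matrix.diagonal_apply, eq_comm]
  rw [eps, h, shiftInv_eq_diagShift, diagShift_mul_diagShift]
  simp

theorem mpow_diagShift_one (k : ℤ) (m : ℕ) :
    mpow (diagShift 1 k : Mat 𝕜) m = diagShift 1 (m * k) := by
  induction m with
  | zero => simp [mpow, one_eq_diagShift]
  | succ m ih =>
    rw [mpow, ih, diagShift_mul_diagShift]
    congr 1
    · funext i
      simp
    · push_cast
      ring

theorem zpow_diagShift_one (k l : ℤ) :
    zpow (diagShift 1 k : Mat 𝕜) (diagShift 1 (-k)) l = diagShift 1 (l * k) := by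
  cases l with
  | ofNat n => exact mpow_diagShift_one k n
  | negSucc n =>
    rw [zpow, mpow_diagShift_one, Int.negSucc_eq]
    congr 1
    push_cast
    ring

theorem zpow_shift (l : ℤ) : zpow (shift : Mat 𝕜) shiftInv l = diagShift 1 l := by
  rw [shift_eq_diagShift, shiftInv_eq_diagShift, zpow_diagShift_one, mul_one]

theorem zpow_shiftInv (l : ℤ) : zpow (shiftInv : Mat 𝕜) shift l = diagShift 1 (-l) := by
  have h := zpow_diagShift_one (𝕜 := 𝕜) (-1) l
  rwa [neg_neg, mul_neg_one, ← shift_eq_diagShift, ← shiftInv_eq_diagShift] at h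

theorem mpow_eps (m : ℕ) : mpow (eps : Mat 𝕜) m =
    diagShift (fun i => (m.factorial : 𝕜) * (Ring.choose i m : ℤ)) (-m) := by
  -- The falling factorial `i(i-1)⋯(i-m+1)` obeys the recursion of the powers of `ε`; it is
  -- converted to a binomial coefficient afterwards.
  have h : mpow (eps : Mat 𝕜) m =
      diagShift (fun i => ((Polynomial.smeval (descPochhammer ℤ m) i : ℤ) : 𝕜)) (-m) := by
    rw [eps_eq_diagShift]
    induction m with
    | zero => simp [mpow, one_eq_diagShift]; rfl
    | succ m ih =>
      rw [mpow, ih, diagShift_mul_diagShift]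
      congr 1
      · funext i
        rw [← Int.cast_mul, descPochhammer_succ_right, Polynomial.smeval_mul,
          Polynomial.smeval_sub, Polynomial.smeval_X, pow_one, Polynomial.smeval_natCast,
          pow_zero, nsmul_one, sub_eq_add_neg]
      · push_cast
        ring
  rw [h]
  congr 1
  funext i
  rw [Ring.descPochhammer_eq_factorial_smul_choose, nsmul_eq_mul]
  push_cast
  rfl

/-! ### Bands of the wave operators -/

/-- The time multiplying the `(2n+1)`-st power has weight exactly `2n+1`, which compensates the
shift and leaves offset `0`. -/
theorem banded_xi {s e : ℤ} (he : s * e = 1) {t : ℕ → Time} (ht : ∀ n, Sum.elim id id (t n) = n) :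
    Banded s 0 (xi t (diagShift 1 e : Mat 𝕜)) := by
  classical
  intro n i j h
  unfold xi
  rw [coeff_fsum]
  refine finsum_eq_zero_of_forall_eq_zero fun k => ?_
  rw [mpow_diagShift_one, diagShift]
  split_ifs with hj
  · rw [Pi.one_apply, map_one, mul_one, MvPowerSeries.coeff_X, if_neg]
    rintro rfl
    have h2 : s * (j - i) = (2 * k + 1) * (s * e) := by
      rw [hj]
      push_cast
      ring
    rw [wt_single, ht, h2, he] at h
    push_cast at h
    omega
  · rw [mul_zero, map_zero]

theorem isBanded_waveOp1 {S : Mat 𝕜} (hS : ∀ i j, i < j → S i j = 0) :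
    IsBanded 1 (waveOp1 S) := by
  refine IsBanded.mul ⟨0, fun n i j h => ?_⟩ ⟨0, Banded.mexp ?_⟩
  · have := wt_nonneg n
    rw [hS i j (by omega), map_zero]
  · rw [shift_eq_diagShift]
    exact banded_xi (by norm_num) fun _ => rfl

theorem isBanded_waveOp2 {S : Mat 𝕜} (hS : ∀ i j, j < i → S i j = 0) :
    IsBanded (-1) (waveOp2 S) := by
  refine IsBanded.mul ⟨0, fun n i j h => ?_⟩ ⟨0, Banded.mexp ?_⟩
  · have := wt_nonneg n
    rw [hS i j (by omega), map_zero]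
  · rw [shiftInv_eq_diagShift]
    exact banded_xi (by norm_num) fun _ => rfl

/-! ### Products with `K` -/

theorem neg_one_zpow_mul_self (a : ℤ) : (-1 : 𝕜) ^ a * (-1) ^ a = 1 := by
  rw [← mul_zpow, neg_one_mul, neg_neg, one_zpow]

theorem neg_one_zpow_neg (a : ℤ) : (-1 : 𝕜) ^ (-a) = (-1) ^ a := by
  rw [← inv_zpow', inv_neg_one]

theorem neg_one_zpow_add_one (a : ℤ) : (-1 : 𝕜) ^ (a + 1) = -(-1) ^ a := by
  rw [zpow_add_one₀ (neg_ne_zero.mpr one_ne_zero), mul_neg_one]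

theorem mulVec_matK (q : ℤ → Ser (Fn 𝕜)) (i : ℤ) (m : ℕ) (p : ℤ) :
    mulVec matK q i m p = (-1 : 𝕜) ^ (i + 1) • q (-1 - i) m p := by
  unfold mulVec
  rw [fsum_eq_single _ (-1 - i)]
  · rw [matK_apply, if_pos (by ring), ← MvPowerSeries.smul_eq_C_mul]
  · intro k hk
    rw [matK_apply, if_neg (by omega), zero_mul]

theorem conj_matKinv_transpose (A : Mat 𝕜) (i j : ℤ) :
    conj matKinv A.transpose matK i j = (-1 : 𝕜) ^ (i + j) • A (-1 - j) (-1 - i) := by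
  have h1 : ∀ k, mul matKinv A.transpose i k = (-1 : 𝕜) ^ i • A k (-1 - i) := by
    intro k
    unfold mul matKinv
    rw [fsum_eq_single _ (-1 - i)]
    · rw [Matrix.neg_apply, matK_apply, if_pos (by ring), neg_one_zpow_add_one, map_neg, neg_neg,
        ← MvPowerSeries.smul_eq_C_mul, Matrix.transpose_apply]
    · intro l hl
      rw [Matrix.neg_apply, matK_apply, if_neg (by omega), neg_zero, zero_mul]
  unfold conj
  rw [mul, fsum_eq_single _ (-1 - j)]
  · rw [h1, matK_apply, if_pos (by ring), mul_comm, ← MvPowerSeries.smul_eq_C_mul, smul_smul,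
      show -1 - j + 1 = -j by ring, neg_one_zpow_neg,
      zpow_add₀ (neg_ne_zero.mpr one_ne_zero), mul_comm]
  · intro k hk
    rw [matK_apply, if_neg (by omega), mul_zero]

/-- The reflection `(i, j) ↦ (-1 - j, -1 - i)` preserves `j - i`. With the constraint, this supplies
the band of the inverse wave operators. -/
theorem IsBanded.conj_matKinv_transpose {s : ℤ} {A : Mat 𝕜} (hA : IsBanded s A) :
    IsBanded s (conj matKinv A.transpose matK) := by
  obtain ⟨c, hA⟩ := hA
  refine ⟨c, fun n i j h => ?_⟩
  rw [CTLHierarchy.conj_matKinv_transpose, MvPowerSeries.coeff_smul, hA, mul_zero]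
  rwa [show -1 - i - (-1 - j) = j - i by ring]

/-! ### Conjugation by an invertible banded matrix -/

/-- `B` is the banded inverse of the banded matrix `A`, and is given by the CTL constraint. -/
structure IsCTLPair (s : ℤ) (A B : Mat 𝕜) : Prop where
  sign : s = 1 ∨ s = -1
  left : IsBanded s A
  right : IsBanded s B
  mul_inv : mul A B = 1
  inv_mul : mul B A = 1
  inv_apply : ∀ i j, B i j = (-1 : 𝕜) ^ (i + j) • A (-1 - j) (-1 - i)

namespace IsCTLPair

variable {s : ℤ} {A B X Y : Mat 𝕜}

theorem conj_mul_conj (h : IsCTLPair s A B) (hX : IsBanded s X) (hY : IsBanded s Y) :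
    mul (conj A X B) (conj A Y B) = conj A (mul X Y) B := by
  unfold conj
  have hAX := h.left.mul hX
  rw [← mul_assoc_of_isBanded h.sign (hAX.mul h.right) (h.left.mul hY) h.right,
    mul_assoc_of_isBanded h.sign hAX h.right (h.left.mul hY),
    ← mul_assoc_of_isBanded h.sign h.right h.left hY, h.inv_mul, one_mul_mat,
    mul_assoc_of_isBanded h.sign h.left hX hY]

theorem conj_one (h : IsCTLPair s A B) : conj A 1 B = 1 := by
  rw [conj, mul_one_mat, h.mul_inv]

theorem mpow_conj (h : IsCTLPair s A B) (hX : IsBanded s X) (m : ℕ) :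
    mpow (conj A X B) m = conj A (mpow X m) B := by
  induction m with
  | zero => exact h.conj_one.symm
  | succ m ih => rw [mpow, mpow, ih, h.conj_mul_conj (hX.mpow m) hX]

theorem zpow_conj (h : IsCTLPair s A B) (hX : IsBanded s X) (hY : IsBanded s Y) (l : ℤ) :
    zpow (conj A X B) (conj A Y B) l = conj A (zpow X Y l) B := by
  cases l with
  | ofNat n => exact h.mpow_conj hX n
  | negSucc n => exact h.mpow_conj hY (n + 1)

/-- The left side is a component of `K` applied to column `r` of `A`; the constraint makes it an
entry of the inverse. -/
theorem smul_apply_neg_one_sub (h : IsCTLPair s A B) (r j : ℤ) :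
    (-1 : 𝕜) ^ (j + 1) • A (-1 - j) r = (-1 : 𝕜) ^ r • B (-1 - r) j := by
  have e : (-1 : 𝕜) ^ r * (-1) ^ (-1 - r + j) = (-1) ^ (j + 1) := by
    rw [← zpow_add₀ (neg_ne_zero.mpr one_ne_zero), show j + 1 = r + (-1 - r + j) + 2 by ring,
      zpow_add₀ (neg_ne_zero.mpr one_ne_zero) _ 2]
    norm_num
  rw [h.inv_apply, smul_smul, e, sub_sub_cancel]

theorem fsummable_conj_diagShift (h : IsCTLPair s A B) (c : ℤ → 𝕜) (e : ℤ ≃ ℤ) (k i j : ℤ) :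
    FSummable fun q => c q • (A i (e q) * B (e q + k) j) :=
  ((h.left.fsummable h.sign h.right i j k).comp_injective e.injective).smul c

end IsCTLPair

/-- The bijection `e` matches the diagonal index with the exponent summed over in `serMul`: a
translation for `Ψ₁(μ)`, a reflection for `Ψ₂(λ⁻¹)`. -/
theorem conj_diagShift_apply (A B : Mat 𝕜) (c : ℤ → 𝕜) (k : ℤ) (e : ℤ ≃ ℤ) (i j : ℤ) :
    conj A (diagShift c k) B i j = fsum fun q => c (e q) • (A i (e q) * B (e q + k) j) := by
  rw [conj, mul, ← fsum_comp_equiv (e.trans (Equiv.addRight k))]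
  congr 1
  funext q
  rw [mul_diagShift, Equiv.trans_apply, Equiv.coe_addRight, add_sub_cancel_right, smul_mul_assoc]

theorem conj_diagShift_smul (A B : Mat 𝕜) (a : 𝕜) (c : ℤ → 𝕜) (k : ℤ) :
    conj A (diagShift (fun i => a * c i) k) B = a • conj A (diagShift c k) B := by
  funext i j
  rw [Matrix.smul_apply, conj_diagShift_apply _ _ _ _ (Equiv.refl ℤ),
    conj_diagShift_apply _ _ _ _ (Equiv.refl ℤ), smul_fsum]
  simp only [mul_smul]

/-! ### Products of formal series -/

theorem serMul_eq_of_right {F G : Ser (Fn 𝕜)} (hG : ∀ b p, b ≠ 0 → G b p = 0) (m : ℕ) (p : ℤ) :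
    serMul F G m p = fsum fun q => F m q * G 0 (p - q) := by
  unfold serMul
  rw [Finset.sum_eq_single (m, 0)]
  · rintro ⟨a, b⟩ hab hne
    have hb : b ≠ 0 := by
      rintro rfl
      exact hne (by simpa using hab)
    simp only [hG _ _ hb, mul_zero, fsum_zero]
  · simp

theorem serMul_eq_of_left {F G : Ser (Fn 𝕜)} (hF : ∀ a p, a ≠ 0 → F a p = 0) (m : ℕ) (p : ℤ) :
    serMul F G m p = fsum fun q => F 0 q * G m (p - q) := by
  unfold serMul
  rw [Finset.sum_eq_single (0, m)]
  · rintro ⟨a, b⟩ hab hne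
    have ha : a ≠ 0 := by
      rintro rfl
      exact hne (by simpa using hab)
    simp only [hF _ _ ha, zero_mul, fsum_zero]
  · simp

theorem sqMatrix_apply (q₁ q₂ : ℤ → Ser (Fn 𝕜)) (m : ℕ) (p : ℤ) :
    sqMatrix q₁ q₂ m p = tensor q₁ (mulVec matK q₂) m p + tensor q₂ (mulVec matK q₁) m p :=
  rfl

theorem waveFn_apply (A : Mat 𝕜) (i p : ℤ) : waveFn A i p = A i p := by
  unfold waveFn
  rw [fsum_eq_single _ p]
  · simp
  · intro k hk
    rw [if_neg hk.symm, mul_zero]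

namespace Solution

variable (w : Solution 𝕜)

theorem isCTLPair_one : IsCTLPair 1 w.W1 w.W1inv where
  sign := Or.inl rfl
  left := isBanded_waveOp1 w.S1_lower
  right := w.constraint1 ▸ (isBanded_waveOp1 w.S1_lower).conj_matKinv_transpose
  mul_inv := w.W1_mul_inv
  inv_mul := w.W1_inv_mul
  inv_apply i j := by rw [← w.constraint1]; exact conj_matKinv_transpose _ i j

theorem isCTLPair_two : IsCTLPair (-1) w.W2 w.W2inv where
  sign := Or.inr rfl
  left := isBanded_waveOp2 w.S2_upper
  right := w.constraint2 ▸ (isBanded_waveOp2 w.S2_upper).conj_matKinv_transpose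
  mul_inv := w.W2_mul_inv
  inv_mul := w.W2_inv_mul
  inv_apply i j := by rw [← w.constraint2]; exact conj_matKinv_transpose _ i j

/-! ### The additional symmetries in terms of conjugated diagonals -/

theorem A1_eq (m : ℕ) (k : ℤ) : w.A1 m (m + k) = (m.factorial : 𝕜) •
    (conj w.W1 (diagShift (fun i => (Ring.choose i m : ℤ)) k) w.W1inv
      - (-1 : 𝕜) ^ (m + k) •
        conj w.W1 (diagShift (fun i => (Ring.choose (i + k + m) m : ℤ)) k) w.W1inv) := by
  have h := w.isCTLPair_one
  have hs : ∀ c k, IsBanded 1 (diagShift c k : Mat 𝕜) := isBanded_diagShift 1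
  have hz : zpow w.L1 w.L1inv (m + k) = conj w.W1 (diagShift 1 (m + k)) w.W1inv := by
    rw [← zpow_shift]
    exact h.zpow_conj (shift_eq_diagShift (𝕜 := 𝕜) ▸ hs _ _)
      (shiftInv_eq_diagShift (𝕜 := 𝕜) ▸ hs _ _) _
  have hm : mpow w.M1 m = conj w.W1 (mpow eps m) w.W1inv :=
    h.mpow_conj (eps_eq_diagShift (𝕜 := 𝕜) ▸ hs _ _) m
  have h1 : mul (mpow eps m) (diagShift 1 (m + k)) =
      diagShift (fun i => (m.factorial : 𝕜) * (Ring.choose i m : ℤ)) k := by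
    rw [mpow_eps, diagShift_mul_diagShift, neg_add_cancel_left]
    simp only [Pi.one_apply, mul_one]
  have h2 : mul (diagShift 1 (m + k)) (mpow eps m) =
      diagShift (fun i => (m.factorial : 𝕜) * (Ring.choose (i + k + m) m : ℤ)) k := by
    rw [mpow_eps, diagShift_mul_diagShift, add_neg_cancel_comm]
    simp only [Pi.one_apply, one_mul, add_assoc, add_comm k]
  have he : IsBanded 1 (mpow (eps : Mat 𝕜) m) := mpow_eps (𝕜 := 𝕜) m ▸ hs _ _
  rw [A1, hz, hm, h.conj_mul_conj he (hs _ _), h.conj_mul_conj (hs _ _) he, h1, h2,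
    conj_diagShift_smul, conj_diagShift_smul, smul_sub, smul_comm]

theorem A2_zero_eq (k : ℤ) : w.A2 0 k = conj w.W2 (diagShift 1 (-k)) w.W2inv
    - (-1 : 𝕜) ^ k • conj w.W2 (diagShift 1 (-k)) w.W2inv := by
  have hs : ∀ c k, IsBanded (-1) (diagShift c k : Mat 𝕜) := isBanded_diagShift (-1)
  have hz : zpow w.L2 w.L2inv k = conj w.W2 (diagShift 1 (-k)) w.W2inv := by
    rw [← zpow_shiftInv]
    exact w.isCTLPair_two.zpow_conj (shiftInv_eq_diagShift (𝕜 := 𝕜) ▸ hs _ _)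
      (shift_eq_diagShift (𝕜 := 𝕜) ▸ hs _ _) _
  rw [A2, hz, mpow, one_mul_mat, mul_one_mat]

/-! ### The squared eigenfunction matrices -/

theorem psi1Mu_apply (i : ℤ) (m : ℕ) (p : ℤ) :
    w.psi1Mu i m p = ((Ring.choose (p + m) m : ℤ) : 𝕜) • w.W1 i (p + m) := by
  rw [psi1Mu, atMu, waveFn_apply, Int.cast_smul_eq_zsmul]

theorem psi1NegLam_apply (i : ℤ) (m : ℕ) (p : ℤ) :
    w.psi1NegLam i m p = if m = 0 then (-1 : 𝕜) ^ p • w.W1 i p else 0 := by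
  rw [psi1NegLam, atLam, subNeg, waveFn_apply]

theorem mulVec_matK_psi1Mu (j : ℤ) (m : ℕ) (p : ℤ) :
    mulVec matK w.psi1Mu j m p =
      ((-1 : 𝕜) ^ (p + m) * (Ring.choose (p + m) m : ℤ)) • w.W1inv (-1 - (p + m)) j := by
  rw [mulVec_matK, psi1Mu_apply, smul_comm, w.isCTLPair_one.smul_apply_neg_one_sub, smul_smul,
    mul_comm]

theorem mulVec_matK_psi1NegLam (j : ℤ) (m : ℕ) (p : ℤ) :
    mulVec matK w.psi1NegLam j m p = if m = 0 then w.W1inv (-1 - p) j else 0 := by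
  rw [mulVec_matK, psi1NegLam_apply]
  split_ifs
  · rw [smul_comm, w.isCTLPair_one.smul_apply_neg_one_sub, smul_smul, neg_one_zpow_mul_self,
      one_smul]
  · rw [smul_zero]

theorem psi1Mu_mul_mulVec_matK_psi1NegLam (i j : ℤ) (a : ℕ) (p q : ℤ) :
    w.psi1Mu i a q * mulVec matK w.psi1NegLam j 0 (p - q) =
      ((Ring.choose (q + a) a : ℤ) : 𝕜) •
        (w.W1 i (q + a) * w.W1inv (q + a + (-p - a - 1)) j) := by
  rw [psi1Mu_apply, mulVec_matK_psi1NegLam, if_pos rfl, smul_mul_assoc]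
  congr 3
  ring

theorem psi1NegLam_mul_mulVec_matK_psi1Mu (i j : ℤ) (b : ℕ) (p q : ℤ) :
    w.psi1NegLam i 0 q * mulVec matK w.psi1Mu j b (p - q) =
      ((-1 : 𝕜) ^ (p + b) * (Ring.choose (p - q + b) b : ℤ)) •
        (w.W1 i q * w.W1inv (q + (-p - b - 1)) j) := by
  rw [psi1NegLam_apply, mulVec_matK_psi1Mu, if_pos rfl, smul_mul_smul_comm, ← mul_assoc,
    ← zpow_add₀ (neg_ne_zero.mpr one_ne_zero)]
  have e₁ : q + (p - q + b) = p + b := by ring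
  have e₂ : -1 - (p - q + b) = q + (-p - b - 1) := by ring
  rw [e₁, e₂]

theorem sqMatrix_psi1 (m : ℕ) (k : ℤ) :
    sqMatrix w.psi1Mu w.psi1NegLam m (-k - m - 1) =
      conj w.W1 (diagShift (fun i => (Ring.choose i m : ℤ)) k) w.W1inv
      - (-1 : 𝕜) ^ (m + k) •
        conj w.W1 (diagShift (fun i => (Ring.choose (i + k + m) m : ℤ)) k) w.W1inv := by
  have hk : -(-k - m - 1) - m - 1 = k := by ring
  rw [sqMatrix_apply, sub_eq_add_neg (conj _ _ _), ← neg_smul, ← conj_diagShift_smul]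
  refine congrArg₂ (· + ·) ?_ ?_ <;> funext i j
  -- The coefficient of `(μ - λ)^m λ^q` in `Ψ₁(μ)` uses column `q + m` of `W₁`, hence the
  -- translation by `m`.
  · rw [tensor, serMul_eq_of_right, conj_diagShift_apply _ _ _ _ (Equiv.addRight (m : ℤ))]
    · simp only [psi1Mu_mul_mulVec_matK_psi1NegLam, hk, Equiv.coe_addRight]
    · intro b p hb
      rw [mulVec_matK_psi1NegLam, if_neg hb]
  · rw [tensor, serMul_eq_of_left, conj_diagShift_apply _ _ _ _ (Equiv.refl ℤ)]
    · simp only [psi1NegLam_mul_mulVec_matK_psi1Mu, hk, Equiv.refl_apply]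
      congr 1
      funext q
      have hc : Ring.choose (-k - m - 1 - q + m : ℤ) m =
          (-1) ^ m * Ring.choose (q + k + m : ℤ) m := by
        -- This is `(-n choose m) = (-1)^m (n + m - 1 choose m)` with `n = q + k + 1`.
        rw [show -k - m - 1 - q + m = -(q + k + 1) by ring, Ring.choose_neg, Int.negOnePow_def,
          show q + k + 1 + m - 1 = q + k + m by ring, Units.smul_def]
        simp
      have hp : (-1 : 𝕜) ^ (-k - m - 1 + m : ℤ) = -(-1) ^ k := by
        rw [← neg_one_zpow_neg, ← neg_one_zpow_add_one]
        congr 1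
        ring
      rw [hc, hp, zpow_add₀ (neg_ne_zero.mpr one_ne_zero), zpow_natCast]
      push_cast
      congr 1
      ring
    · intro a p ha
      rw [psi1NegLam_apply, if_neg ha]

/-- Any lower part is banded on the side of `W₁` and any upper part on the side of `W₂`, so only the
Kronecker products need checking. -/
theorem sqFlowDefined_of {q₁ q₂ : ℤ → Ser (Fn 𝕜)}
    (h₁ : ∀ i j, SerMulDefined (q₁ i) (mulVec matK q₂ j))
    (h₂ : ∀ i j, SerMulDefined (q₂ i) (mulVec matK q₁ j)) : w.SqFlowDefined q₁ q₂ :=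
  ⟨fun i j => ⟨h₁ i j, h₂ i j⟩, fun _ _ =>
    ⟨(isBanded_low _).mulDefined (Or.inl rfl) w.isCTLPair_one.left,
      (isBanded_up _).mulDefined (Or.inr rfl) w.isCTLPair_two.left⟩⟩

theorem sqFlowDefined_psi1 : w.SqFlowDefined w.psi1Mu w.psi1NegLam := by
  refine w.sqFlowDefined_of (fun i j a b p => ?_) fun i j a b p => ?_
  · rcases eq_or_ne b 0 with rfl | hb
    · simp only [psi1Mu_mul_mulVec_matK_psi1NegLam]
      exact w.isCTLPair_one.fsummable_conj_diagShift _ (Equiv.addRight (a : ℤ)) _ i j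
    · simp only [mulVec_matK_psi1NegLam, if_neg hb, mul_zero]
      exact fsummable_zero
  · rcases eq_or_ne a 0 with rfl | ha
    · simp only [psi1NegLam_mul_mulVec_matK_psi1Mu]
      exact w.isCTLPair_one.fsummable_conj_diagShift _ (Equiv.refl ℤ) _ i j
    · simp only [psi1NegLam_apply, if_neg ha, zero_mul]
      exact fsummable_zero

/-- The first generator `-λ⁻¹ Ψ₂(λ⁻¹)` of the flow `∂_{α₂}`. -/
noncomputable def negLamInvPsi2 : ℤ → Ser (Fn 𝕜) := fun i => -lamMul (-1) (w.psi2InvLam i)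

/-- The second generator `λ⁻¹ Ψ₂(-λ⁻¹)` of the flow `∂_{α₂}`. -/
noncomputable def lamInvPsi2Neg : ℤ → Ser (Fn 𝕜) := fun i => lamMul (-1) (w.psi2NegInvLam i)

theorem negLamInvPsi2_apply (i : ℤ) (m : ℕ) (p : ℤ) :
    w.negLamInvPsi2 i m p = if m = 0 then -w.W2 i (-1 - p) else 0 := by
  have e : -(p - -1) = -1 - p := by ring
  simp only [negLamInvPsi2, Pi.neg_apply, lamMul, psi2InvLam, atLam, subInv, waveFn_apply, e]
  split_ifs <;> simp

theorem lamInvPsi2Neg_apply (i : ℤ) (m : ℕ) (p : ℤ) :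
    w.lamInvPsi2Neg i m p = if m = 0 then (-1 : 𝕜) ^ (-1 - p) • w.W2 i (-1 - p) else 0 := by
  have e : -(p - -1) = -1 - p := by ring
  simp only [lamInvPsi2Neg, lamMul, psi2NegInvLam, atLam, subInv, subNeg, waveFn_apply, e]

theorem mulVec_matK_negLamInvPsi2 (j : ℤ) (m : ℕ) (p : ℤ) :
    mulVec matK w.negLamInvPsi2 j m p =
      if m = 0 then -((-1 : 𝕜) ^ (-1 - p) • w.W2inv p j) else 0 := by
  rw [mulVec_matK, negLamInvPsi2_apply]
  split_ifs
  · rw [smul_neg, w.isCTLPair_two.smul_apply_neg_one_sub, sub_sub_cancel]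
  · rw [smul_zero]

theorem mulVec_matK_lamInvPsi2Neg (j : ℤ) (m : ℕ) (p : ℤ) :
    mulVec matK w.lamInvPsi2Neg j m p = if m = 0 then w.W2inv p j else 0 := by
  rw [mulVec_matK, lamInvPsi2Neg_apply]
  split_ifs
  · rw [smul_comm, w.isCTLPair_two.smul_apply_neg_one_sub, smul_smul, neg_one_zpow_mul_self,
      one_smul, sub_sub_cancel]
  · rw [smul_zero]

theorem negLamInvPsi2_mul_mulVec_matK (i j p q : ℤ) :
    w.negLamInvPsi2 i 0 q * mulVec matK w.lamInvPsi2Neg j 0 (p - q) =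
      (-1 : 𝕜) • (w.W2 i (-1 - q) * w.W2inv (-1 - q + (p + 1)) j) := by
  rw [negLamInvPsi2_apply, mulVec_matK_lamInvPsi2Neg, if_pos rfl, if_pos rfl, neg_smul, one_smul,
    neg_mul]
  congr 3
  ring

theorem lamInvPsi2Neg_mul_mulVec_matK (i j p q : ℤ) :
    w.lamInvPsi2Neg i 0 q * mulVec matK w.negLamInvPsi2 j 0 (p - q) =
      (-1 : 𝕜) ^ (p + 1) • (w.W2 i (-1 - q) * w.W2inv (-1 - q + (p + 1)) j) := by
  rw [lamInvPsi2Neg_apply, mulVec_matK_negLamInvPsi2, if_pos rfl, if_pos rfl, mul_neg,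
    smul_mul_smul_comm, ← zpow_add₀ (neg_ne_zero.mpr one_ne_zero), ← neg_smul,
    ← neg_one_zpow_add_one]
  have e₁ : -1 - q + (-1 - (p - q)) + 1 = -(p + 1) := by ring
  have e₂ : p - q = -1 - q + (p + 1) := by ring
  rw [e₁, e₂, neg_one_zpow_neg]

theorem sqMatrix_psi2 (k : ℤ) : sqMatrix w.negLamInvPsi2 w.lamInvPsi2Neg 0 (-k - 1) =
    -w.A2 0 k := by
  have hk : -k - 1 + 1 = -k := by ring
  rw [sqMatrix_apply, A2_zero_eq, neg_sub, sub_eq_neg_add (_ • _),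
    ← neg_one_smul 𝕜 (conj _ _ _), ← conj_diagShift_smul, ← conj_diagShift_smul]
  refine congrArg₂ (· + ·) ?_ ?_ <;> funext i j
  -- The coefficient of `λ^q` in `λ⁻¹ Ψ₂(λ⁻¹)` is column `-1 - q` of `W₂`, hence the reflection.
  · rw [tensor, serMul_eq_of_right, conj_diagShift_apply _ _ _ _ (Equiv.subLeft (-1))]
    · simp only [negLamInvPsi2_mul_mulVec_matK, hk, Equiv.subLeft_apply, Pi.one_apply, mul_one]
    · intro b p hb
      rw [mulVec_matK_lamInvPsi2Neg, if_neg hb]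
  · rw [tensor, serMul_eq_of_right, conj_diagShift_apply _ _ _ _ (Equiv.subLeft (-1))]
    · simp only [lamInvPsi2Neg_mul_mulVec_matK, hk, Equiv.subLeft_apply, Pi.one_apply, mul_one,
        neg_one_zpow_neg]
    · intro b p hb
      rw [mulVec_matK_negLamInvPsi2, if_neg hb]

theorem sqMatrix_psi2_of_ne_zero {m : ℕ} (hm : m ≠ 0) (p : ℤ) :
    sqMatrix w.negLamInvPsi2 w.lamInvPsi2Neg m p = 0 := by
  rw [sqMatrix_apply, ← add_zero (0 : Mat 𝕜)]
  refine congrArg₂ (· + ·) ?_ ?_ <;> funext i j <;> rw [tensor, serMul_eq_of_right]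
  · simp only [negLamInvPsi2_apply, if_neg hm, zero_mul, fsum_zero, Matrix.zero_apply]
  · intro b p hb
    rw [mulVec_matK_lamInvPsi2Neg, if_neg hb]
  · simp only [lamInvPsi2Neg_apply, if_neg hm, zero_mul, fsum_zero, Matrix.zero_apply]
  · intro b p hb
    rw [mulVec_matK_negLamInvPsi2, if_neg hb]

theorem sqFlowDefined_psi2 : w.SqFlowDefined w.negLamInvPsi2 w.lamInvPsi2Neg := by
  refine w.sqFlowDefined_of (fun i j a b p => ?_) fun i j a b p => ?_ <;>
    rcases eq_or_ne a 0 with rfl | ha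
  · rcases eq_or_ne b 0 with rfl | hb
    · simp only [negLamInvPsi2_mul_mulVec_matK]
      exact w.isCTLPair_two.fsummable_conj_diagShift _ (Equiv.subLeft (-1)) _ i j
    · simp only [mulVec_matK_lamInvPsi2Neg, if_neg hb, mul_zero]
      exact fsummable_zero
  · simp only [negLamInvPsi2_apply, if_neg ha, zero_mul]
    exact fsummable_zero
  · rcases eq_or_ne b 0 with rfl | hb
    · simp only [lamInvPsi2Neg_mul_mulVec_matK]
      exact w.isCTLPair_two.fsummable_conj_diagShift _ (Equiv.subLeft (-1)) _ i j
    · simp only [mulVec_matK_negLamInvPsi2, if_neg hb, mul_zero]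
      exact fsummable_zero
  · simp only [lamInvPsi2Neg_apply, if_neg ha, zero_mul]
    exact fsummable_zero

/-! ### Comparison of the flows -/

theorem addX_eq (m : ℕ) (l : ℤ) :
    w.addX m l = (-mul (low (w.A1 m l)) w.W1, mul (up (w.A1 m l)) w.W2) := by
  simp only [addX, pmul, minusPart, W, low_zero, up_zero, sub_zero, zero_sub, neg_mul_mat,
    Prod.neg_mk, neg_neg]

/-- The two slots of `minusPart` enter with opposite signs: `addY` has the sign pattern of `sqFlow`
and `addX` the opposite one. This is why `A₁` appears in the squared eigenfunction matrix with a
plus and `A₂` with a minus. -/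
theorem addY_eq (m : ℕ) (l : ℤ) :
    w.addY m l = (mul (low (w.A2 m l)) w.W1, -mul (up (w.A2 m l)) w.W2) := by
  simp only [addY, pmul, minusPart, W, low_zero, up_zero, sub_zero, zero_sub, neg_mul_mat,
    Prod.neg_mk, neg_neg]

theorem sqFlow_eq_smul {q₁ q₂ : ℤ → Ser (Fn 𝕜)} {m : ℕ} {p : ℤ} {c : 𝕜} {A : Mat 𝕜}
    (h : sqMatrix q₁ q₂ m p = c • A) :
    w.sqFlow q₁ q₂ m p = c • (mul (low A) w.W1, -mul (up A) w.W2) := by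
  rw [sqFlow, h, low_smul, up_smul, smul_mul_mat, smul_mul_mat, Prod.smul_mk, smul_neg]

end Solution
end CTLHierarchy

theorem mainTheorem6 {𝕜 : Type*} [Field 𝕜] [CharZero 𝕜] (w : CTLHierarchy.Solution 𝕜) :
    (w.SqFlowDefined w.psi1Mu w.psi1NegLam ∧
      ∀ (m : ℕ) (k : ℤ),
        w.alpha1 m (-k - m - 1) = -(((m.factorial : 𝕜)⁻¹) • w.addX m (m + k))) ∧
    (w.SqFlowDefined (fun i => -CTLHierarchy.lamMul (-1) (w.psi2InvLam i))
        (fun i => CTLHierarchy.lamMul (-1) (w.psi2NegInvLam i)) ∧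
      (∀ k : ℤ, w.alpha2 0 (-k - 1) = -w.addY 0 k) ∧
      ∀ (m : ℕ) (p : ℤ), m ≠ 0 → w.alpha2 m p = 0) := by
  refine ⟨⟨w.sqFlowDefined_psi1, fun m k => ?_⟩, w.sqFlowDefined_psi2, fun k => ?_,
    fun m p hm => ?_⟩
  -- Characteristic zero enters here, to divide by `m!`.
  · have hm : (m.factorial : 𝕜) ≠ 0 := Nat.cast_ne_zero.mpr m.factorial_ne_zero
    have h : CTLHierarchy.sqMatrix w.psi1Mu w.psi1NegLam m (-k - m - 1) =
        (m.factorial : 𝕜)⁻¹ • w.A1 m (m + k) := by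
      rw [w.sqMatrix_psi1, w.A1_eq, inv_smul_smul₀ hm]
    rw [CTLHierarchy.Solution.alpha1, w.sqFlow_eq_smul h, w.addX_eq, ← smul_neg, Prod.neg_mk,
      neg_neg]
  · have h := w.sqMatrix_psi2 k
    rw [← neg_one_smul 𝕜 (w.A2 0 k)] at h
    rw [w.addY_eq, ← neg_one_smul 𝕜 (_, _)]
    exact w.sqFlow_eq_smul h
  · have h := w.sqMatrix_psi2_of_ne_zero hm p
    -- The zero matrix is written as a multiple by `0`, so that `sqFlow_eq_smul` applies with `c =
    -- 0`.
    rw [← zero_smul 𝕜 (0 : CTLHierarchy.Mat 𝕜)] at h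
    exact (w.sqFlow_eq_smul h).trans (zero_smul 𝕜 _)
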